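/- Let $n\in\{2,3\}$, $k\ge 1$, and fix one of the two families RT or BDM. Let $\Omega\subset\mathbb R^n$ be a domain with polygonal/polyhedral boundary and $\mathcal K_h$ a finite conforming partition of $\Omega$ into simplices, with face set $\mathcal E_h$; let $h_K,h_E$ be the diameters of elements and faces, and call $\mathcal K_h$ $\kappa$-shape-regular if $h_K\le\kappa\rho_K$ for all $K\in\mathcal K_h$, where $\rho_K$ is the diameter of the largest ball contained in $K$. Let $\tilde{\boldsymbol V}_h$ be the space of vector fields $\boldsymbol v$ with $\boldsymbol v|_K\in[P_{k-1}(K)]^n\oplus \boldsymbol x\tilde P_{k-1}(K)$ (RT; $\tilde P_{k-1}$ denotes homogeneous polynomials of degree $k-1$), respectively $\boldsymbol v|_K\in[P_k(K)]^n$ (BDM), for all $K\in\mathcal K_h$, and let $\boldsymbol V_h=\tilde{\boldsymbol V}_h\cap H(\mathrm{div},\Omega)$. Let $\sigma>0$ be constant on each element, $t\ge 0$, and let $\mathcal M_h\subset[L^2(\mathcal E_h)]^n$ be any linear subspace. With $\boldsymbol n$ the outward unit normal on $\partial K$ and $\boldsymbol u_{\boldsymbol\tau}=\boldsymbol u-(\boldsymbol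 u\cdot\boldsymbol n)\boldsymbol n$, all traces on $\partial K$ being taken from inside $K$, define $$a_h(\boldsymbol u,\boldsymbol m;\boldsymbol v,\boldsymbol r)=(\sigma^2\boldsymbol u,\boldsymbol v)+t^2\sum_{K\in\mathcal K_h}\Big\{(\nabla\boldsymbol u,\nabla\boldsymbol v)_K+\sum_{E\subset\partial K}\Big[\tfrac{2\alpha}{h_E}\langle\boldsymbol u_{\boldsymbol\tau}-\boldsymbol m,\boldsymbol v_{\boldsymbol\tau}-\boldsymbol r\rangle_E-\langle\tfrac{\partial\boldsymbol u}{\partial n},\boldsymbol v_{\boldsymbol\tau}-\boldsymbol r\rangle_E-\langle\tfrac{\partial\boldsymbol v}{\partial n},\boldsymbol u_{\boldsymbol\tau}-\boldsymbol m\rangle_E\Big]\Big\},$$ $$\|(\boldsymbol u,\boldsymbol m)\|_{\sigma,t,h}^2=\sum_{K\in\mathcal K_h}\sigma^2\|\boldsymbol u\|_{0,K}^2+t^2\Big[\sum_{K\in\mathcal K_h}\|\nabla\boldsymbol u\|_{0,K}^2+\sum_{K\in\mathcal K_h}\sum_{E\subset\partial K}\tfrac1{h_E}\|\boldsymbol u_{\boldsymbol\tau}-\boldsymbol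 m\|_{0,E}^2\Big].$$ For $\boldsymbol W_h\in\{\boldsymbol V_h,\tilde{\boldsymbol V}_h\}$ and $C_I>0$ consider the discrete inverse trace inequality $$h_E\Big\|\frac{\partial\boldsymbol v}{\partial n}\Big\|_{0,E}^2\le C_I\|\nabla\boldsymbol v\|_{0,K}^2\qquad\forall\,\boldsymbol v\in\boldsymbol W_h,\ K\in\mathcal K_h,\ E\subset\partial K.\tag{I}$$ (i) For every $\kappa>0$ there is $C_I>0$, depending only on $\kappa$, $n$, $k$ and the family, such that (I) holds for both choices of $\boldsymbol W_h$ on every domain $\Omega$ and every $\kappa$-shape-regular partition of it. (ii) For every $C_I>0$ and every $\alpha>(n+1)C_I/2$ there is a constant $C>0$, depending only on $C_I$, $\alpha$, $n$, $k$ and the family (hence not on $\Omega$, the partition, $\sigma$, $t$ or $\mathcal M_h$), such that whenever (I) holds for $\boldsymbol W_h$ with the constant $C_I$, then for every choice of $\mathcal M_h$ $$a_h(\boldsymbol v,\boldsymbol m;\boldsymbol v,\boldsymbol m)\ \ge\ C\,\|(\boldsymbol v,\boldsymbol m)\|_{\sigma,t,h}^2\qquad\forall\,(\boldsymbol v,\boldsymbol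 m)\in\boldsymbol W_h\times\mathcal M_h .$$ -/

import Mathlib

open MeasureTheory
open scoped ContDiff

noncomputable section

namespace Brinkman

/-- The space `ℝⁿ` with its Euclidean structure. -/
abbrev Eu (n : ℕ) : Type := EuclideanSpace ℝ (Fin n)

/-- A finite, conforming partition of (the closure of) `Ω ⊆ ℝⁿ` into `n`-simplices: a finite
simplicial complex all of whose faces lie in an `n`-simplex, which fills the closure of `Ω`
and whose `(n-1)`-simplices contain the (polygonal / polyhedral) boundary of `Ω`. Simplices are
given by their sets of vertices. -/
structure SimplicialMesh {n : ℕ} (Ω : Set (Eu n)) extends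
    Geometry.SimplicialComplex ℝ (Eu n) where
  finite_faces : faces.Finite
  pure : ∀ F ∈ faces, ∃ K ∈ faces, F ⊆ K ∧ K.card = n + 1
  space_eq : toSimplicialComplex.space = closure Ω
  frontier_subset : frontier Ω ⊆
    ⋃ F ∈ {F | F ∈ faces ∧ F.card = n}, convexHull ℝ (F : Set (Eu n))

/-- The closed simplex with vertex set `s`. -/
def hull {n : ℕ} (s : Finset (Eu n)) : Set (Eu n) := convexHull ℝ (s : Set (Eu n))

/-- The diameter (`h_K` of an element, `h_E` of a face). -/
def size {n : ℕ} (s : Finset (Eu n)) : ℝ := Metric.diam (hull s)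

open Classical in
/-- The face of the simplex `K` opposite to its vertex `p`. The faces `E ⊆ ∂K` are the
`face K p` with `p ∈ K`. -/
def face {n : ℕ} (K : Finset (Eu n)) (p : Eu n) : Finset (Eu n) := K.erase p

/-- The outward unit normal of the simplex `K` on its face opposite to `p`: the normalized
component, orthogonal to that face, of the vector from `p` to the centroid of the face. -/
def outwardNormal {n : ℕ} (K : Finset (Eu n)) (p : Eu n) : Eu n :=
  let w : Eu n := (vectorSpan ℝ (face K p : Set (Eu n)))ᗮ.starProjection
    ((face K p).centroid ℝ id - p)
  ‖w‖⁻¹ • w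

/-- The tangential component `u - (u ⬝ ν) ν` with respect to the unit normal `ν`. -/
def tangential {n : ℕ} (ν u : Eu n) : Eu n := u - (inner ℝ u ν) • ν

/-- The pointwise Frobenius product `∇u : ∇v`. -/
def gradInner {n : ℕ} (u v : Eu n → Eu n) (x : Eu n) : ℝ :=
  ∑ i : Fin n, inner ℝ (fderiv ℝ u x (EuclideanSpace.single i 1))
    (fderiv ℝ v x (EuclideanSpace.single i 1))

/-- The normal derivative `∂u/∂ν`. -/
def normalDeriv {n : ℕ} (ν : Eu n) (u : Eu n → Eu n) (x : Eu n) : Eu n := fderiv ℝ u x ν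

/-- The integral over the simplex `K`, with respect to Lebesgue measure. -/
def elemInt {n : ℕ} (K : Finset (Eu n)) (f : Eu n → ℝ) : ℝ := ∫ x in hull K, f x

/-- The integral over an `(n-1)`-dimensional face, with respect to surface measure. -/
def faceInt {n : ℕ} (F : Finset (Eu n)) (f : Eu n → ℝ) : ℝ := ∫ x in hull F, f x ∂μHE[n - 1]

namespace SimplicialMesh

variable {n : ℕ} {Ω : Set (Eu n)}

/-- The elements `K` of the mesh, i.e. its `n`-simplices. -/
def elements (T : SimplicialMesh Ω) : Finset (Finset (Eu n)) :=
  {K ∈ T.finite_faces.toFinset | K.card = n + 1}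

/-- The union of all the `(n-1)`-dimensional faces of the mesh. -/
def skeleton (T : SimplicialMesh Ω) : Set (Eu n) :=
  ⋃ F ∈ {F | F ∈ T.faces ∧ F.card = n}, hull F

/-- Surface measure on the skeleton. -/
def skeletonMeasure (T : SimplicialMesh Ω) : Measure (Eu n) :=
  (μHE[n - 1] : Measure (Eu n)).restrict T.skeleton

/-- `h_K ≤ κ ρ_K` for all elements `K`, where `ρ_K` is the diameter of the largest ball
contained in `K`. -/
def ShapeRegular (T : SimplicialMesh Ω) (κ : ℝ) : Prop :=
  ∀ K ∈ T.elements, ∃ (c : Eu n) (ρ : ℝ), 0 < ρ ∧ Metric.closedBall c ρ ⊆ hull K ∧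
    size K ≤ κ * (2 * ρ)

end SimplicialMesh

/-- The two families of elements: Raviart-Thomas (Nédélec) and Brezzi-Douglas-Marini (BDDF). -/
inductive Family where
  | RT
  | BDM

/-- The local polynomial space of order `k ≥ 1`: `[P_{k-1}]ⁿ ⊕ x P̃_{k-1}` for RT (with
`P̃_{k-1}` the homogeneous polynomials of degree `k-1`), and `[P_k]ⁿ` for BDM. -/
def IsLocalField {n : ℕ} (k : ℕ) : Family → (Eu n → Eu n) → Prop
  | .RT, f => ∃ (a : Fin n → MvPolynomial (Fin n) ℝ) (q : MvPolynomial (Fin n) ℝ),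
      (∀ i, (a i).totalDegree ≤ k - 1) ∧ q.IsHomogeneous (k - 1) ∧
      ∀ x i, f x i = MvPolynomial.eval (fun j => x j) (a i) +
        x i * MvPolynomial.eval (fun j => x j) q
  | .BDM, f => ∃ a : Fin n → MvPolynomial (Fin n) ℝ,
      (∀ i, (a i).totalDegree ≤ k) ∧ ∀ x i, f x i = MvPolynomial.eval (fun j => x j) (a i)

/-- An elementwise defined vector field: `v K` is the restriction of the field to the element
`K`. For a piecewise polynomial field, `v K` is the unique polynomial field on `ℝⁿ` extending
that restriction, so its values on `∂K` are the traces from inside `K`. -/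
abbrev BrokenField (n : ℕ) : Type := Finset (Eu n) → Eu n → Eu n

/-- The field on `Ω` with the given restrictions to the interiors of the elements
(and the value `0` on the Lebesgue null set formed by the faces). -/
def glue {n : ℕ} {Ω : Set (Eu n)} (T : SimplicialMesh Ω) (v : BrokenField n) : Eu n → Eu n :=
  fun x => ∑ K ∈ T.elements, (interior (hull K)).indicator (v K) x

/-- Membership in `H(div, Ω)`: the field is in `L²(Ω)` and has a weak divergence in `L²(Ω)`. -/
def MemHdiv {n : ℕ} (Ω : Set (Eu n)) (v : Eu n → Eu n) : Prop :=
  MemLp v 2 (volume.restrict Ω) ∧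
  ∃ g : Eu n → ℝ, MemLp g 2 (volume.restrict Ω) ∧
    ∀ φ : Eu n → ℝ, ContDiff ℝ ∞ φ → HasCompactSupport φ → tsupport φ ⊆ Ω →
      ∫ x in Ω, fderiv ℝ φ x (v x) = - ∫ x in Ω, g x * φ x

/-- The discontinuous space `Ṽ_h`: the fields whose restriction to each element is in the local
polynomial space. -/
def brokenSpace {n : ℕ} {Ω : Set (Eu n)} (T : SimplicialMesh Ω) (fam : Family) (k : ℕ) :
    Set (BrokenField n) :=
  {v | ∀ K ∈ T.elements, IsLocalField k fam (v K)}

/-- The `H(div)`-conforming space `V_h`. -/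
def conformingSpace {n : ℕ} {Ω : Set (Eu n)} (T : SimplicialMesh Ω) (fam : Family) (k : ℕ) :
    Set (BrokenField n) :=
  {v | v ∈ brokenSpace T fam k ∧ MemHdiv Ω (glue T v)}

/-- The discrete inverse trace inequality `h_E ‖∂v/∂n‖²_{0,E} ≤ C_I ‖∇v‖²_{0,K}`, for all
`v ∈ V`, all elements `K` and all faces `E ⊆ ∂K`. -/
def InverseTrace {n : ℕ} {Ω : Set (Eu n)} (T : SimplicialMesh Ω) (V : Set (BrokenField n))
    (CI : ℝ) : Prop :=
  ∀ v ∈ V, ∀ K ∈ T.elements, ∀ p ∈ K,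
    size (face K p) * faceInt (face K p) (fun x => ‖normalDeriv (outwardNormal K p) (v K) x‖ ^ 2)
      ≤ CI * elemInt K (fun x => gradInner (v K) (v K) x)

/-- The trace from `K` of `u_τ - m` on the face of `K` opposite to `p`. -/
def tangDiff {n : ℕ} (u : BrokenField n) (m : Eu n → Eu n) (K : Finset (Eu n)) (p : Eu n)
    (x : Eu n) : Eu n :=
  tangential (outwardNormal K p) (u K x) - m x

/-- The hybridized bilinear form `a_h(u, m; v, r)`. -/
def hybridForm {n : ℕ} {Ω : Set (Eu n)} (T : SimplicialMesh Ω) (σ : Finset (Eu n) → ℝ) (t α : ℝ)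
    (u : BrokenField n) (m : Eu n → Eu n) (v : BrokenField n) (r : Eu n → Eu n) : ℝ :=
  ∑ K ∈ T.elements, σ K ^ 2 * elemInt K (fun x => inner ℝ (u K x) (v K x)) +
  t ^ 2 * ∑ K ∈ T.elements, (elemInt K (fun x => gradInner (u K) (v K) x) +
    ∑ p ∈ K,
      (2 * α / size (face K p) *
          faceInt (face K p) (fun x => inner ℝ (tangDiff u m K p x) (tangDiff v r K p x)) -
        faceInt (face K p)
          (fun x => inner ℝ (normalDeriv (outwardNormal K p) (u K) x) (tangDiff v r K p x)) -
        faceInt (face K p)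
          (fun x => inner ℝ (normalDeriv (outwardNormal K p) (v K) x) (tangDiff u m K p x))))

/-- The mesh-dependent norm of a pair `(u, m)`. The sum over the faces counts the trace of `u_τ`
from every element adjacent to the face. -/
def hybridNorm {n : ℕ} {Ω : Set (Eu n)} (T : SimplicialMesh Ω) (σ : Finset (Eu n) → ℝ) (t : ℝ)
    (u : BrokenField n) (m : Eu n → Eu n) : ℝ :=
  √(∑ K ∈ T.elements, σ K ^ 2 * elemInt K (fun x => ‖u K x‖ ^ 2) +
    t ^ 2 * (∑ K ∈ T.elements, elemInt K (fun x => gradInner (u K) (u K) x) +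
      ∑ K ∈ T.elements, ∑ p ∈ K,
        1 / size (face K p) * faceInt (face K p) (fun x => ‖tangDiff u m K p x‖ ^ 2)))

end Brinkman

end

/-!
Both families consist, on each element, of polynomial fields of degree at most `k`, and neither
assertion uses more of them than that.

*Inverse trace inequality.* Pointwise, `|∂v/∂n|² ≤ ∇v : ∇v`, and the entries of `∇v` are polynomials
of degree at most `k`. On this finite-dimensional space the maximum over a ball of radius `2 κ` is
controlled by the `L²`-norm over the concentric unit ball
(`Brinkman.exists_sq_eval_le_integral`). A translation and a dilation carry this over to a ball
`B_ρ ⊆ K` with `h_K ≤ 2 κ ρ`, whose dilate by `2 κ` contains `K`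
(`Brinkman.exists_pow_mul_sq_eval_le_integral`); no reference element or trace theorem is needed.
As a face `E` lies in a hyperplane, its surface measure is at most a dimensional constant times
`h_E ^ (n - 1)` (`Brinkman.euclideanHausdorffMeasure_hull_le`), so that
`h_E |E| ρ⁻ⁿ ≤ const * (h_E / ρ)ⁿ` is bounded in terms of `κ`.

*Coercivity.* On every face, Young's inequality with parameter `ε h_E` bounds `2 ⟨∂v/∂n, v_τ - m⟩_E`
by `ε C_I ‖∇v‖²_K + (ε h_E)⁻¹ ‖v_τ - m‖²_E` (`Brinkman.face_terms_ge`). An element has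
`n + 1` faces, so the form dominates the squared norm with the constant
`min {1, 1 - (n + 1) ε C_I, 2 α - 1 / ε}` (`Brinkman.coercivity`). Exactly when
`α > (n + 1) C_I / 2` is there an `ε` for which this constant is positive.
-/

open MeasureTheory
open scoped ContDiff

namespace Brinkman

/-! ### Polynomials as functions on Euclidean space -/

theorem totalDegree_pderiv_le {ι R : Type*} [CommSemiring R] (i : ι) (p : MvPolynomial ι R) :
    (MvPolynomial.pderiv i p).totalDegree ≤ p.totalDegree := by
  classical
  conv_lhs => rw [p.as_sum, map_sum]
  refine MvPolynomial.totalDegree_finsetSum_le fun m hm => ?_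
  rw [MvPolynomial.pderiv_monomial]
  refine (MvPolynomial.totalDegree_monomial_le _ _).trans
    (le_trans ?_ (MvPolynomial.le_totalDegree hm))
  exact Finsupp.degree_mono tsub_le_self

theorem exists_totalDegree_le_eval_affine {n : ℕ} (c : Fin n → ℝ) (r : ℝ)
    (p : MvPolynomial (Fin n) ℝ) :
    ∃ q : MvPolynomial (Fin n) ℝ, q.totalDegree ≤ p.totalDegree ∧
      ∀ x, MvPolynomial.eval x q = MvPolynomial.eval (fun i => c i + r * x i) p := by
  classical
  have hlin (i : Fin n) :
      (MvPolynomial.C (c i) + MvPolynomial.C r * MvPolynomial.X i :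
        MvPolynomial (Fin n) ℝ).totalDegree ≤ 1 := by
    refine (MvPolynomial.totalDegree_add _ _).trans (max_le (by simp) ?_)
    refine (MvPolynomial.totalDegree_mul _ _).trans ?_
    simp
  refine ⟨MvPolynomial.bind₁
    (fun i => MvPolynomial.C (c i) + MvPolynomial.C r * MvPolynomial.X i) p, ?_, fun x => ?_⟩
  · conv_lhs => rw [p.as_sum, map_sum]
    refine MvPolynomial.totalDegree_finsetSum_le fun m hm => ?_
    rw [MvPolynomial.bind₁_monomial]
    refine (MvPolynomial.totalDegree_mul _ _).trans ?_
    rw [MvPolynomial.totalDegree_C, zero_add]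
    refine (MvPolynomial.totalDegree_finsetProd _ _).trans
      (le_trans ?_ (MvPolynomial.le_totalDegree hm))
    refine Finset.sum_le_sum fun i _ => (MvPolynomial.totalDegree_pow _ _).trans ?_
    simpa using Nat.mul_le_mul_left (m i) (hlin i)
  · rw [MvPolynomial.eval, MvPolynomial.eval₂Hom_bind₁]
    simp only [← MvPolynomial.eval.eq_1, map_add, map_mul, MvPolynomial.eval_C,
      MvPolynomial.eval_X]

theorem hasFDerivAt_eval {n : ℕ} (p : MvPolynomial (Fin n) ℝ) (x : Eu n) :
    HasFDerivAt (fun y : Eu n => MvPolynomial.eval (fun j => y j) p)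
      (∑ i, MvPolynomial.eval (fun j => x j) (MvPolynomial.pderiv i p) •
        (EuclideanSpace.proj i : Eu n →L[ℝ] ℝ)) x := by
  classical
  induction p using MvPolynomial.induction_on with
  | C a => simpa using hasFDerivAt_const a x
  | add p q hp hq =>
    simp only [map_add, add_smul, Finset.sum_add_distrib]
    exact hp.add hq
  | mul_X p i hp =>
    have h := hp.mul ((EuclideanSpace.proj i : Eu n →L[ℝ] ℝ).hasFDerivAt (x := x))
    simp only [map_mul, MvPolynomial.eval_X]
    refine h.congr_fderiv ?_
    ext v
    simp only [MvPolynomial.pderiv_mul, map_add, map_mul, MvPolynomial.eval_X,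
      MvPolynomial.pderiv_X, Finset.sum_add_distrib, add_smul,
      FunLike.coe_add, FunLike.coe_smul, Pi.add_apply, Pi.smul_apply, FunLike.coe_sum,
      Finset.sum_apply, PiLp.proj_apply, smul_eq_mul, Finset.mul_sum, mul_assoc]
    rw [add_comm]
    congr 1
    · exact Finset.sum_congr rfl fun j _ => by ring
    · simp [Pi.single_apply]

theorem contDiff_eval {n : ℕ} (p : MvPolynomial (Fin n) ℝ) :
    ContDiff ℝ ∞ (fun y : Eu n => MvPolynomial.eval (fun j => y j) p) := by
  induction p using MvPolynomial.induction_on with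
  | C a => simpa using contDiff_const
  | add p q hp hq => simpa using hp.add hq
  | mul_X p i hp =>
    simpa using hp.mul (EuclideanSpace.proj i : Eu n →L[ℝ] ℝ).contDiff

/-! ### Local fields and their gradients -/

/-- The elements of either family are polynomial fields of total degree at most `k`; the factor
`x` of the Raviart-Thomas fields raises the degree `k - 1` by one. -/
theorem IsLocalField.exists_eval {n k : ℕ} (hk : 1 ≤ k) {fam : Family} {f : Eu n → Eu n}
    (hf : IsLocalField k fam f) :
    ∃ a : Fin n → MvPolynomial (Fin n) ℝ, (∀ i, (a i).totalDegree ≤ k) ∧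
      ∀ x i, f x i = MvPolynomial.eval (fun j => x j) (a i) := by
  cases fam with
  | BDM => exact hf
  | RT =>
    obtain ⟨a, q, ha, hq, hf⟩ := hf
    refine ⟨fun i => a i + MvPolynomial.X i * q, fun i => ?_, fun x i => by simp [hf]⟩
    refine (MvPolynomial.totalDegree_add _ _).trans (max_le ((ha i).trans (Nat.sub_le _ _)) ?_)
    refine (MvPolynomial.totalDegree_mul _ _).trans ?_
    rw [MvPolynomial.totalDegree_X]
    have := hq.totalDegree_le
    omega

theorem IsLocalField.contDiff {n k : ℕ} (hk : 1 ≤ k) {fam : Family} {f : Eu n → Eu n}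
    (hf : IsLocalField k fam f) : ContDiff ℝ ∞ f := by
  obtain ⟨a, -, ha⟩ := hf.exists_eval hk
  rw [contDiff_euclidean]
  intro i
  simpa only [ha] using contDiff_eval (a i)

theorem gradInner_self_eq {n : ℕ} {f : Eu n → Eu n} {a : Fin n → MvPolynomial (Fin n) ℝ}
    (ha : ∀ x i, f x i = MvPolynomial.eval (fun j => x j) (a i)) (x : Eu n) :
    gradInner f f x =
      ∑ i, ∑ j, MvPolynomial.eval (fun l => x l) (MvPolynomial.pderiv i (a j)) ^ 2 := by
  classical
  have hdiff : HasFDerivAt f (fderiv ℝ f x) x := by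
    refine DifferentiableAt.hasFDerivAt ?_
    rw [differentiableAt_euclidean]
    intro i
    simpa only [ha] using (hasFDerivAt_eval (a i) x).differentiableAt
  refine Finset.sum_congr rfl fun i _ => ?_
  rw [real_inner_self_eq_norm_sq, EuclideanSpace.real_norm_sq_eq]
  refine Finset.sum_congr rfl fun j _ => ?_
  have h1 := HasFDerivAt.congr_of_eventuallyEq
    ((EuclideanSpace.proj j : Eu n →L[ℝ] ℝ).hasFDerivAt.comp x hdiff)
    (Filter.Eventually.of_forall fun y => (ha y j).symm)
  have h2 := DFunLike.congr_fun (h1.unique (hasFDerivAt_eval (a j) x)) (EuclideanSpace.single i 1)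
  have h3 : fderiv ℝ f x (EuclideanSpace.single i 1) j =
      MvPolynomial.eval (fun l => x l) (MvPolynomial.pderiv i (a j)) := by
    simpa [Pi.single_apply] using h2
  rw [h3]

theorem gradInner_self_nonneg {n : ℕ} (f : Eu n → Eu n) (x : Eu n) : 0 ≤ gradInner f f x :=
  Finset.sum_nonneg fun _ _ => real_inner_self_nonneg

theorem continuous_gradInner_self {n : ℕ} {f : Eu n → Eu n} (hf : ContDiff ℝ ∞ f) :
    Continuous (gradInner f f) := by
  have := hf.continuous_fderiv (by simp)
  unfold gradInner
  fun_prop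

/-- The operator norm of the gradient is at most its Frobenius norm. -/
theorem norm_normalDeriv_sq_le {n : ℕ} {ν : Eu n} (hν : ‖ν‖ ≤ 1) (f : Eu n → Eu n) (x : Eu n) :
    ‖normalDeriv ν f x‖ ^ 2 ≤ gradInner f f x := by
  classical
  have hsum : normalDeriv ν f x = ∑ i, ν i • fderiv ℝ f x (EuclideanSpace.single i 1) := by
    have h := (EuclideanSpace.basisFun (Fin n) ℝ).sum_repr ν
    rw [normalDeriv]
    conv_lhs => rw [← h, map_sum]
    simp
  have hν2 : ∑ i, |ν i| ^ 2 ≤ 1 := by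
    have := EuclideanSpace.real_norm_sq_eq ν
    simp only [sq_abs]
    rw [← this]
    nlinarith [norm_nonneg ν]
  calc ‖normalDeriv ν f x‖ ^ 2
      ≤ (∑ i, |ν i| * ‖fderiv ℝ f x (EuclideanSpace.single i 1)‖) ^ 2 := by
        rw [hsum]
        gcongr
        refine (norm_sum_le _ _).trans (Finset.sum_le_sum fun i _ => ?_)
        rw [norm_smul, Real.norm_eq_abs]
    _ ≤ (∑ i, |ν i| ^ 2) * ∑ i, ‖fderiv ℝ f x (EuclideanSpace.single i 1)‖ ^ 2 :=
        Finset.sum_mul_sq_le_sq_mul_sq _ _ _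
    _ ≤ 1 * ∑ i, ‖fderiv ℝ f x (EuclideanSpace.single i 1)‖ ^ 2 := by
        gcongr
    _ = gradInner f f x := by
        simp [gradInner]

theorem norm_outwardNormal_le_one {n : ℕ} (K : Finset (Eu n)) (p : Eu n) :
    ‖outwardNormal K p‖ ≤ 1 := by
  simp only [outwardNormal, norm_smul, norm_inv, norm_norm]
  exact inv_mul_le_one

/-! ### Scaled norm equivalence for polynomials -/

/-- Passing from an injective image of a finite-dimensional space to any other linear image is
bounded. -/
theorem exists_norm_le_mul_norm {V F G : Type*} [AddCommGroup V] [Module ℝ V]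
    [FiniteDimensional ℝ V] [NormedAddCommGroup F] [NormedSpace ℝ F] [NormedAddCommGroup G]
    [NormedSpace ℝ G] (L : V →ₗ[ℝ] F) {A : V →ₗ[ℝ] G} (hA : Function.Injective A) :
    ∃ C : ℝ, 0 ≤ C ∧ ∀ v, ‖L v‖ ≤ C * ‖A v‖ := by
  let e := LinearEquiv.ofInjective A hA
  let B := LinearMap.toContinuousLinearMap (L ∘ₗ e.symm.toLinearMap)
  refine ⟨‖B‖, B.opNorm_nonneg, fun v => ?_⟩
  have h := B.le_opNorm (e v)
  simpa [B, e] using h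

/-- On polynomials of bounded degree, the maximum over a ball is controlled by the `L²`-norm over
the concentric unit ball. -/
theorem exists_sq_eval_le_integral (n k : ℕ) (R : ℝ) :
    ∃ C : ℝ, 0 < C ∧ ∀ q : MvPolynomial (Fin n) ℝ, q.totalDegree ≤ k →
      ∀ y ∈ Metric.closedBall (0 : Eu n) R,
        MvPolynomial.eval (fun j => y j) q ^ 2 ≤
          C * ∫ x in Metric.closedBall (0 : Eu n) 1, MvPolynomial.eval (fun j => x j) q ^ 2 := by
  classical
  let V := MvPolynomial.restrictTotalDegree (Fin n) ℝ k
  have hcont (q : MvPolynomial (Fin n) ℝ) :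
      Continuous fun x : Eu n => MvPolynomial.eval (fun j => x j) q := (contDiff_eval q).continuous
  let μ : Measure (Eu n) := volume.restrict (Metric.closedBall 0 1)
  have : IsFiniteMeasure μ := ⟨by
    simpa [μ] using (isCompact_closedBall (0 : Eu n) 1).measure_lt_top⟩
  have hmem (q : MvPolynomial (Fin n) ℝ) :
      MemLp (fun x : Eu n => MvPolynomial.eval (fun j => x j) q) 2 μ := by
    obtain ⟨M, hM⟩ := (isCompact_closedBall (0 : Eu n) 1).exists_bound_of_continuousOn
      (hcont q).continuousOn
    exact MemLp.of_bound (hcont q).aestronglyMeasurable M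
      (ae_restrict_of_forall_mem measurableSet_closedBall hM)
  let L : V →ₗ[ℝ] C(Metric.closedBall (0 : Eu n) R, ℝ) :=
    { toFun := fun q => ⟨fun x => MvPolynomial.eval (fun j => x.1 j) q.1,
        (hcont q.1).comp continuous_subtype_val⟩
      map_add' := fun p q => by ext; simp
      map_smul' := fun c q => by ext; simp }
  let A : V →ₗ[ℝ] Lp ℝ 2 μ :=
    { toFun := fun q => (hmem q.1).toLp _
      map_add' := fun p q => by
        rw [← MemLp.toLp_add]
        exact MemLp.toLp_congr _ _ (Filter.Eventually.of_forall fun x => by simp)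
      map_smul' := fun c q => by
        rw [RingHom.id_apply, ← MemLp.toLp_const_smul]
        exact MemLp.toLp_congr _ _ (Filter.Eventually.of_forall fun x => by simp) }
  have hA : Function.Injective A := by
    intro p q hpq
    have hae := (MemLp.toLp_eq_toLp_iff (hmem p.1) (hmem q.1)).1 hpq
    have hball : (fun x : Eu n => MvPolynomial.eval (fun j => x j) p.1)
        =ᵐ[volume.restrict (Metric.ball 0 1)] fun x => MvPolynomial.eval (fun j => x j) q.1 :=
      ae_mono (Measure.restrict_mono Metric.ball_subset_closedBall le_rfl) hae
    have heq := Measure.eqOn_open_of_ae_eq hball Metric.isOpen_ball (hcont _).continuousOn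
      (hcont _).continuousOn
    -- The unit ball contains a cube, and a polynomial vanishing on a cube is zero.
    have hnhds : (WithLp.toLp 2 : (Fin n → ℝ) → Eu n) ⁻¹' Metric.ball 0 1 ∈ nhds 0 :=
      (PiLp.continuous_toLp 2 (fun _ : Fin n => ℝ)).continuousAt.preimage_mem_nhds
        (Metric.ball_mem_nhds _ one_pos)
    obtain ⟨ε, hε, hsub⟩ := Metric.mem_nhds_iff.1 hnhds
    refine Subtype.ext (MvPolynomial.funext_set (fun _ => Set.Ioo (-ε) ε)
      (fun _ => Set.Ioo_infinite (by linarith)) fun x hx => ?_)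
    have hx' : x ∈ Metric.ball (0 : Fin n → ℝ) ε := by
      rw [mem_ball_zero_iff, pi_norm_lt_iff hε]
      intro i
      exact abs_lt.2 (hx i (Set.mem_univ i))
    exact heq (hsub hx')
  obtain ⟨C, hC, h⟩ := exists_norm_le_mul_norm L hA
  refine ⟨C ^ 2 + 1, by positivity, fun q hq y hy => ?_⟩
  let q' : V := ⟨q, (MvPolynomial.mem_restrictTotalDegree _ _ _).2 hq⟩
  have hnorm : ‖A q'‖ ^ 2 =
      ∫ x in Metric.closedBall (0 : Eu n) 1, MvPolynomial.eval (fun j => x j) q ^ 2 := by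
    rw [← real_inner_self_eq_norm_sq, L2.inner_def]
    refine integral_congr_ae ?_
    filter_upwards [(hmem q).coeFn_toLp] with x hx
    rw [show (A q' : Eu n → ℝ) x = _ from hx]
    simp
  rw [← hnorm]
  calc MvPolynomial.eval (fun j => y j) q ^ 2 = ‖L q' ⟨y, hy⟩‖ ^ 2 := by
        rw [Real.norm_eq_abs, sq_abs]; rfl
    _ ≤ (C * ‖A q'‖) ^ 2 := by
        gcongr
        exact ((L q').norm_coe_le_norm _).trans (h q')
    _ ≤ (C ^ 2 + 1) * ‖A q'‖ ^ 2 := by nlinarith [sq_nonneg ‖A q'‖]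

/-- The scaled form of `exists_sq_eval_le_integral`. -/
theorem exists_pow_mul_sq_eval_le_integral (n k : ℕ) (R : ℝ) :
    ∃ C : ℝ, 0 < C ∧ ∀ q : MvPolynomial (Fin n) ℝ, q.totalDegree ≤ k →
      ∀ (c : Eu n) (ρ : ℝ), 0 < ρ → ∀ y ∈ Metric.closedBall c (R * ρ),
        ρ ^ n * MvPolynomial.eval (fun j => y j) q ^ 2 ≤
          C * ∫ x in Metric.closedBall c ρ, MvPolynomial.eval (fun j => x j) q ^ 2 := by
  obtain ⟨C, hC, h⟩ := exists_sq_eval_le_integral n k R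
  refine ⟨C, hC, fun q hq c ρ hρ y hy => ?_⟩
  obtain ⟨q', hdeg, heval⟩ := exists_totalDegree_le_eval_affine (fun i => c i) ρ q
  have hev (x : Eu n) : MvPolynomial.eval (fun j => x j) q' =
      MvPolynomial.eval (fun j => (c + ρ • x) j) q := by
    rw [heval]; rfl
  have hy' : ρ⁻¹ • (y - c) ∈ Metric.closedBall (0 : Eu n) R := by
    rw [mem_closedBall_zero_iff, norm_smul, norm_inv, Real.norm_of_nonneg hρ.le,
      inv_mul_le_iff₀ hρ, mul_comm, ← dist_eq_norm]
    exact hy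
  have key := h q' (hdeg.trans hq) _ hy'
  have hcy : c + ρ • ρ⁻¹ • (y - c) = y := by
    rw [smul_inv_smul₀ hρ.ne', add_sub_cancel]
  have hint : ∫ x in Metric.closedBall (0 : Eu n) 1,
        MvPolynomial.eval (fun j => (c + ρ • x) j) q ^ 2 =
      (ρ ^ n)⁻¹ * ∫ x in Metric.closedBall c ρ, MvPolynomial.eval (fun j => x j) q ^ 2 := by
    have h1 := Measure.setIntegral_comp_smul_of_pos (volume : Measure (Eu n))
      (fun x => MvPolynomial.eval (fun j => (c + x) j) q ^ 2) (Metric.closedBall 0 1) hρ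
    have h2 := (measurePreserving_add_left (volume : Measure (Eu n)) c).setIntegral_preimage_emb
      (measurableEmbedding_addLeft c) (fun x => MvPolynomial.eval (fun j => x j) q ^ 2)
      (Metric.closedBall c ρ)
    have h3 : (c + ·) ⁻¹' Metric.closedBall c ρ = Metric.closedBall (0 : Eu n) ρ := by
      ext x; simp
    rw [h3] at h2
    rw [h1, finrank_euclideanSpace_fin, smul_unitClosedBall_of_nonneg hρ.le, h2, smul_eq_mul]
  simp only [hev, hcy] at key
  rw [hint] at key
  have hpos : 0 < ρ ^ n := by positivity
  calc ρ ^ n * MvPolynomial.eval (fun j => y j) q ^ 2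
      ≤ ρ ^ n * (C * ((ρ ^ n)⁻¹ *
        ∫ x in Metric.closedBall c ρ, MvPolynomial.eval (fun j => x j) q ^ 2)) := by gcongr
    _ = _ := by field_simp

/-! ### Faces of a mesh -/

/-- An affinely independent set of `n` points spans a hyperplane, which is isometric to `ℝⁿ⁻¹`;
its convex hull is contained in a ball of that hyperplane. -/
theorem euclideanHausdorffMeasure_hull_le {n : ℕ} {F : Finset (Eu n)} (hF : F.card = n)
    (hne : F.Nonempty) (hind : AffineIndependent ℝ ((↑) : F → Eu n)) :
    (μHE[n - 1] : Measure (Eu n)) (hull F) ≤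
      ENNReal.ofReal (size F ^ (n - 1)) * volume (Metric.closedBall (0 : Eu (n - 1)) 1) := by
  obtain ⟨p, hp⟩ := hne
  have hrank : Module.finrank ℝ (vectorSpan ℝ (F : Set (Eu n))) = n - 1 := by
    have h := hind.finrank_vectorSpan (n := n - 1) (by
      have := Finset.card_pos.2 ⟨p, hp⟩
      rw [Fintype.card_coe]; omega)
    rwa [show Set.range ((↑) : F → Eu n) = F from Subtype.range_coe] at h
  let b := (stdOrthonormalBasis ℝ (vectorSpan ℝ (F : Set (Eu n)))).reindex (finCongr hrank)
  let g : Eu (n - 1) → Eu n := fun x => p + (b.repr.symm x : Eu n)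
  have hg : Isometry g := (isometry_add_left p).comp
    (isometry_subtype_coe.comp b.repr.symm.isometry)
  have hpF : p ∈ hull F := subset_convexHull ℝ _ hp
  have hbdd : Bornology.IsBounded (hull F) := isBounded_convexHull.2 F.finite_toSet.isBounded
  have hsub : hull F ⊆ g '' Metric.closedBall 0 (size F) := by
    intro x hx
    have hmem : x - p ∈ vectorSpan ℝ (F : Set (Eu n)) := by
      rw [← direction_affineSpan]
      exact AffineSubspace.vsub_mem_direction (convexHull_subset_affineSpan _ hx)
        (convexHull_subset_affineSpan _ hpF)
    refine ⟨b.repr ⟨x - p, hmem⟩, ?_, by simp [g]⟩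
    rw [mem_closedBall_zero_iff, LinearIsometryEquiv.norm_map, Submodule.coe_norm, ← dist_eq_norm]
    exact Metric.dist_le_diam_of_mem hbdd hx hpF
  calc (μHE[n - 1] : Measure (Eu n)) (hull F)
      ≤ μHE[n - 1] (g '' Metric.closedBall 0 (size F)) := measure_mono hsub
    _ = volume (Metric.closedBall (0 : Eu (n - 1)) (size F)) := by
        rw [hg.euclideanHausdorffMeasure_image,
          EuclideanSpace.euclideanHausdorffMeasure_eq_volume]
    _ = _ := by
        have hsize : 0 ≤ size F := Metric.diam_nonneg
        rw [Measure.addHaar_closedBall' _ _ hsize, finrank_euclideanSpace_fin]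

theorem isCompact_hull {n : ℕ} (F : Finset (Eu n)) : IsCompact (hull F) :=
  F.finite_toSet.isCompact_convexHull ℝ

namespace SimplicialMesh

variable {n : ℕ} {Ω : Set (Eu n)} (T : SimplicialMesh Ω)

theorem mem_elements {K : Finset (Eu n)} : K ∈ T.elements ↔ K ∈ T.faces ∧ K.card = n + 1 := by
  simp [elements]

variable {T}

theorem card_face {K : Finset (Eu n)} (hK : K ∈ T.elements) {p : Eu n} (hp : p ∈ K) :
    (face K p).card = n := by
  classical
  have := (T.mem_elements.1 hK).2
  rw [face, Finset.card_erase_of_mem hp]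
  omega

theorem face_mem_faces (hn : 2 ≤ n) {K : Finset (Eu n)} (hK : K ∈ T.elements) {p : Eu n}
    (hp : p ∈ K) : face K p ∈ T.faces := by
  classical
  refine T.down_closed (T.mem_elements.1 hK).1 (Finset.erase_subset _ _) ?_
  rw [← Finset.card_pos, card_face hK hp]
  omega

theorem size_face_pos (hn : 2 ≤ n) {K : Finset (Eu n)} (hK : K ∈ T.elements) {p : Eu n}
    (hp : p ∈ K) : 0 < size (face K p) := by
  obtain ⟨x, hx, y, hy, hxy⟩ := Finset.one_lt_card.1 (by rw [card_face hK hp]; omega :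
    1 < (face K p).card)
  exact (dist_pos.2 hxy).trans_le (Metric.dist_le_diam_of_mem (isCompact_hull _).isBounded
    (subset_convexHull ℝ _ hx) (subset_convexHull ℝ _ hy))

theorem measure_face_le (hn : 2 ≤ n) {K : Finset (Eu n)} (hK : K ∈ T.elements) {p : Eu n}
    (hp : p ∈ K) : (μHE[n - 1] : Measure (Eu n)) (hull (face K p)) ≤
      ENNReal.ofReal (size (face K p) ^ (n - 1)) *
        volume (Metric.closedBall (0 : Eu (n - 1)) 1) :=
  have h := face_mem_faces hn hK hp
  euclideanHausdorffMeasure_hull_le (card_face hK hp) (T.nonempty_of_mem_faces h) (T.indep h)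

theorem measure_face_lt_top (hn : 2 ≤ n) {K : Finset (Eu n)} (hK : K ∈ T.elements) {p : Eu n}
    (hp : p ∈ K) : (μHE[n - 1] : Measure (Eu n)) (hull (face K p)) < ⊤ :=
  (measure_face_le hn hK hp).trans_lt
    (ENNReal.mul_lt_top ENNReal.ofReal_lt_top (isCompact_closedBall _ _).measure_lt_top)

theorem hull_face_subset_skeleton (hn : 2 ≤ n) {K : Finset (Eu n)} (hK : K ∈ T.elements)
    {p : Eu n} (hp : p ∈ K) : hull (face K p) ⊆ T.skeleton :=
  Set.subset_biUnion_of_mem (u := fun F => hull F)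
    (show face K p ∈ {F | F ∈ T.faces ∧ F.card = n} from
      ⟨face_mem_faces hn hK hp, card_face hK hp⟩)

end SimplicialMesh

/-! ### The discrete inverse trace inequality -/

/-- On a shape-regular simplex, the pointwise values of the gradient of a polynomial field are
controlled by the `L²`-norm of the gradient over an inscribed ball. -/
theorem exists_pow_mul_gradInner_le (n k : ℕ) (R : ℝ) :
    ∃ C : ℝ, 0 < C ∧ ∀ (f : Eu n → Eu n) (a : Fin n → MvPolynomial (Fin n) ℝ),
      (∀ i, (a i).totalDegree ≤ k) →
      (∀ x i, f x i = MvPolynomial.eval (fun j => x j) (a i)) →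
      ∀ (c : Eu n) (ρ : ℝ), 0 < ρ → ∀ y ∈ Metric.closedBall c (R * ρ),
        ρ ^ n * gradInner f f y ≤ C * ∫ x in Metric.closedBall c ρ, gradInner f f x := by
  obtain ⟨C, hC, h⟩ := exists_pow_mul_sq_eval_le_integral n k R
  refine ⟨C, hC, fun f a hdeg ha c ρ hρ y hy => ?_⟩
  have hint (i j : Fin n) : IntegrableOn
      (fun x : Eu n => MvPolynomial.eval (fun l => x l) (MvPolynomial.pderiv i (a j)) ^ 2)
      (Metric.closedBall c ρ) :=
    ((contDiff_eval _).continuous.pow 2).continuousOn.integrableOn_compact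
      (isCompact_closedBall _ _)
  simp only [gradInner_self_eq ha]
  rw [integral_finsetSum _ fun i _ => integrable_finsetSum _ fun j _ => hint i j,
    Finset.mul_sum, Finset.mul_sum]
  refine Finset.sum_le_sum fun i _ => ?_
  rw [integral_finsetSum _ fun j _ => hint i j, Finset.mul_sum, Finset.mul_sum]
  exact Finset.sum_le_sum fun j _ =>
    h _ ((totalDegree_pderiv_le i (a j)).trans (hdeg j)) c ρ hρ y hy

/-- Shape regularity puts the element in a ball whose radius is a bounded multiple of the radius
of an inscribed ball, so the surface measure of a face is compensated by the volume of that
inscribed ball. -/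
theorem exists_inverseTrace (n : ℕ) (hn : 2 ≤ n) (fam : Family) (k : ℕ) (hk : 1 ≤ k) (κ : ℝ)
    (hκ : 0 < κ) :
    ∃ CI : ℝ, 0 < CI ∧ ∀ (Ω : Set (Eu n)) (T : SimplicialMesh Ω), T.ShapeRegular κ →
      InverseTrace T (brokenSpace T fam k) CI := by
  obtain ⟨C, hC, hgrad⟩ := exists_pow_mul_gradInner_le n k (2 * κ)
  set B : ℝ := volume.real (Metric.closedBall (0 : Eu (n - 1)) 1) with hB
  have hBpos : 0 < B := ENNReal.toReal_pos
    (Metric.measure_closedBall_pos _ _ one_pos).ne' (isCompact_closedBall _ _).measure_lt_top.ne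
  refine ⟨(2 * κ) ^ n * B * C, by positivity, fun Ω T hT v hv K hK p hp => ?_⟩
  classical
  obtain ⟨a, hdeg, ha⟩ := (hv K hK).exists_eval hk
  have hsmooth := (hv K hK).contDiff hk
  obtain ⟨c, ρ, hρ, hball, hsize⟩ := hT K hK
  have hsub : hull (face K p) ⊆ hull K :=
    convexHull_mono (Finset.coe_subset.2 (Finset.erase_subset _ _))
  set I := elemInt K (fun x => gradInner (v K) (v K) x)
  set h := size (face K p)
  have hh : 0 ≤ h := Metric.diam_nonneg
  have hhκ : h ≤ 2 * κ * ρ := by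
    have : h ≤ size K := Metric.diam_mono hsub (isCompact_hull K).isBounded
    linarith
  have hI : 0 ≤ I := integral_nonneg fun x => gradInner_self_nonneg _ _
  have hballI : ∫ x in Metric.closedBall c ρ, gradInner (v K) (v K) x ≤ I :=
    setIntegral_mono_set
      ((continuous_gradInner_self hsmooth).continuousOn.integrableOn_compact (isCompact_hull K))
      (Filter.Eventually.of_forall fun x => gradInner_self_nonneg _ _)
      (Filter.Eventually.of_forall hball)
  have hpt : ∀ x ∈ hull (face K p),
      ‖‖normalDeriv (outwardNormal K p) (v K) x‖ ^ 2‖ ≤ C * I / ρ ^ n := by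
    intro x hx
    rw [Real.norm_of_nonneg (by positivity), le_div_iff₀ (by positivity), mul_comm]
    have hx' : x ∈ Metric.closedBall c (2 * κ * ρ) := by
      have := Metric.dist_le_diam_of_mem (isCompact_hull K).isBounded (hsub hx)
        (hball (Metric.mem_closedBall_self hρ.le))
      rw [Metric.mem_closedBall]
      exact this.trans (hsize.trans_eq (by ring))
    calc ρ ^ n * ‖normalDeriv (outwardNormal K p) (v K) x‖ ^ 2
        ≤ ρ ^ n * gradInner (v K) (v K) x := by
          gcongr
          exact norm_normalDeriv_sq_le (norm_outwardNormal_le_one K p) _ _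
      _ ≤ C * ∫ x in Metric.closedBall c ρ, gradInner (v K) (v K) x :=
          hgrad _ a hdeg ha c ρ hρ x hx'
      _ ≤ C * I := by gcongr
  have hmeas : (μHE[n - 1] : Measure (Eu n)).real (hull (face K p)) ≤ h ^ (n - 1) * B := by
    have := ENNReal.toReal_mono
      (ENNReal.mul_lt_top ENNReal.ofReal_lt_top (isCompact_closedBall _ _).measure_lt_top).ne
      (SimplicialMesh.measure_face_le hn hK hp)
    rwa [ENNReal.toReal_mul, ENNReal.toReal_ofReal (by positivity)] at this
  have hface : faceInt (face K p)
      (fun x => ‖normalDeriv (outwardNormal K p) (v K) x‖ ^ 2) ≤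
        C * I / ρ ^ n * (h ^ (n - 1) * B) :=
    calc _ ≤ C * I / ρ ^ n * (μHE[n - 1] : Measure (Eu n)).real (hull (face K p)) :=
          (le_abs_self _).trans (norm_setIntegral_le_of_norm_le_const
            (SimplicialMesh.measure_face_lt_top hn hK hp) hpt)
      _ ≤ _ := by gcongr
  calc h * faceInt (face K p) (fun x => ‖normalDeriv (outwardNormal K p) (v K) x‖ ^ 2)
      ≤ h * (C * I / ρ ^ n * (h ^ (n - 1) * B)) := by gcongr
    _ = h ^ n * (B * C * I / ρ ^ n) := by
        rw [← mul_pow_sub_one (by omega : n ≠ 0) h]; ring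
    _ ≤ (2 * κ * ρ) ^ n * (B * C * I / ρ ^ n) := by gcongr
    _ = (2 * κ) ^ n * B * C * I := by
        rw [mul_pow]; field_simp

/-! ### Coercivity -/

/-- Young's inequality with a parameter, integrated. -/
theorem two_mul_integral_inner_le {X E : Type*} [MeasurableSpace X] {μ : Measure X}
    [NormedAddCommGroup E] [InnerProductSpace ℝ E] {g d : X → E} (hg : MemLp g 2 μ)
    (hd : MemLp d 2 μ) {δ : ℝ} (hδ : 0 < δ) :
    2 * ∫ x, inner ℝ (g x) (d x) ∂μ ≤ δ * ∫ x, ‖g x‖ ^ 2 ∂μ + δ⁻¹ * ∫ x, ‖d x‖ ^ 2 ∂μ := by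
  have hg2 : Integrable (fun x => ‖g x‖ ^ 2) μ := hg.integrable_norm_pow two_ne_zero
  have hd2 : Integrable (fun x => ‖d x‖ ^ 2) μ := hd.integrable_norm_pow two_ne_zero
  have hgd : Integrable (fun x => inner ℝ (g x) (d x)) μ := by
    refine (hg2.add hd2).mono' (hg.1.inner hd.1) (Filter.Eventually.of_forall fun x => ?_)
    refine (norm_inner_le_norm _ _).trans ?_
    simp only [Pi.add_apply]
    nlinarith [sq_nonneg (‖g x‖ - ‖d x‖), sq_nonneg ‖g x‖, sq_nonneg ‖d x‖]
  rw [← integral_const_mul, ← integral_const_mul, ← integral_const_mul,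
    ← integral_add (hg2.const_mul _) (hd2.const_mul _)]
  refine integral_mono (hgd.const_mul _) ((hg2.const_mul _).add (hd2.const_mul _)) fun x => ?_
  have hin := real_inner_le_norm (g x) (d x)
  have hsq : δ * ‖g x‖ ^ 2 + δ⁻¹ * ‖d x‖ ^ 2 - 2 * (‖g x‖ * ‖d x‖) =
      δ⁻¹ * (δ * ‖g x‖ - ‖d x‖) ^ 2 := by
    field_simp
    ring
  have : 0 ≤ δ⁻¹ * (δ * ‖g x‖ - ‖d x‖) ^ 2 := by positivity
  simp only
  linarith

theorem memLp_face_of_continuous {n : ℕ} (hn : 2 ≤ n) {Ω : Set (Eu n)} {T : SimplicialMesh Ω}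
    {K : Finset (Eu n)} (hK : K ∈ T.elements) {p : Eu n} (hp : p ∈ K) {f : Eu n → Eu n}
    (hf : Continuous f) :
    MemLp f 2 ((μHE[n - 1] : Measure (Eu n)).restrict (hull (face K p))) := by
  have : IsFiniteMeasure ((μHE[n - 1] : Measure (Eu n)).restrict (hull (face K p))) :=
    ⟨by simpa using SimplicialMesh.measure_face_lt_top hn hK hp⟩
  obtain ⟨M, hM⟩ := (isCompact_hull (face K p)).exists_bound_of_continuousOn hf.continuousOn
  exact MemLp.of_bound hf.aestronglyMeasurable M
    (ae_restrict_of_forall_mem (isCompact_hull _).isClosed.measurableSet hM)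

/-- The contribution of one face to the hybridized form, bounded from below: the consistency terms
are absorbed partly by the gradient, through the inverse trace inequality, and partly by the
penalty term. -/
theorem face_terms_ge {n : ℕ} (hn : 2 ≤ n) {Ω : Set (Eu n)} {T : SimplicialMesh Ω} {k : ℕ}
    (hk : 1 ≤ k) {fam : Family} {V : Set (BrokenField n)} {CI : ℝ} (hV : InverseTrace T V CI)
    {v : BrokenField n} (hvV : v ∈ V) (hv : v ∈ brokenSpace T fam k) {m : Eu n → Eu n}
    (hm : MemLp m 2 T.skeletonMeasure) {K : Finset (Eu n)} (hK : K ∈ T.elements) {p : Eu n}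
    (hp : p ∈ K) (α : ℝ) {ε : ℝ} (hε : 0 < ε) :
    (2 * α - ε⁻¹) * (1 / size (face K p) *
        faceInt (face K p) (fun x => ‖tangDiff v m K p x‖ ^ 2)) -
      ε * CI * elemInt K (fun x => gradInner (v K) (v K) x) ≤
    2 * α / size (face K p) *
        faceInt (face K p) (fun x => inner ℝ (tangDiff v m K p x) (tangDiff v m K p x)) -
      faceInt (face K p)
        (fun x => inner ℝ (normalDeriv (outwardNormal K p) (v K) x) (tangDiff v m K p x)) -
      faceInt (face K p)
        (fun x => inner ℝ (normalDeriv (outwardNormal K p) (v K) x) (tangDiff v m K p x)) := by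
  have hsmooth := (hv K hK).contDiff hk
  have hg : MemLp (normalDeriv (outwardNormal K p) (v K)) 2
      ((μHE[n - 1] : Measure (Eu n)).restrict (hull (face K p))) := by
    refine memLp_face_of_continuous hn hK hp ?_
    have := hsmooth.continuous_fderiv (by simp)
    unfold normalDeriv
    fun_prop
  have hd : MemLp (tangDiff v m K p) 2
      ((μHE[n - 1] : Measure (Eu n)).restrict (hull (face K p))) := by
    refine MemLp.sub (memLp_face_of_continuous hn hK hp ?_) (hm.mono_measure
      (Measure.restrict_mono (SimplicialMesh.hull_face_subset_skeleton hn hK hp) le_rfl))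
    have := hsmooth.continuous
    unfold tangential
    fun_prop
  have hpos := SimplicialMesh.size_face_pos hn hK hp
  have hyoung := two_mul_integral_inner_le hg hd (mul_pos hε hpos)
  have htrace := mul_le_mul_of_nonneg_left (hV v hvV K hK p hp) hε.le
  simp only [real_inner_self_eq_norm_sq]
  unfold faceInt at *
  have h1 : (2 * α - ε⁻¹) * (1 / size (face K p) *
      ∫ x in hull (face K p), ‖tangDiff v m K p x‖ ^ 2 ∂μHE[n - 1]) =
      2 * α / size (face K p) *
        ∫ x in hull (face K p), ‖tangDiff v m K p x‖ ^ 2 ∂μHE[n - 1] -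
      (ε * size (face K p))⁻¹ *
        ∫ x in hull (face K p), ‖tangDiff v m K p x‖ ^ 2 ∂μHE[n - 1] := by
    field_simp
  rw [h1]
  linarith

/-- Coercivity with an explicit constant, for every Young parameter `ε`. -/
theorem coercivity {n : ℕ} (hn : 2 ≤ n) {Ω : Set (Eu n)} {T : SimplicialMesh Ω} {k : ℕ}
    (hk : 1 ≤ k) {fam : Family} {V : Set (BrokenField n)} {CI : ℝ} (hV : InverseTrace T V CI)
    {v : BrokenField n} (hvV : v ∈ V) (hv : v ∈ brokenSpace T fam k) {m : Eu n → Eu n}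
    (hm : MemLp m 2 T.skeletonMeasure) (σ : Finset (Eu n) → ℝ) (t α : ℝ) {ε : ℝ} (hε : 0 < ε)
    {C : ℝ} (hC1 : C ≤ 1) (hCgrad : C ≤ 1 - (n + 1) * (ε * CI)) (hCpen : C ≤ 2 * α - ε⁻¹) :
    C * hybridNorm T σ t v m ^ 2 ≤ hybridForm T σ t α v m v m := by
  have hvol (K : Finset (Eu n)) : 0 ≤ σ K ^ 2 * elemInt K (fun x => ‖v K x‖ ^ 2) :=
    mul_nonneg (sq_nonneg _) (integral_nonneg fun x => by positivity)
  have hgrad (K : Finset (Eu n)) : 0 ≤ elemInt K (fun x => gradInner (v K) (v K) x) :=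
    integral_nonneg fun x => gradInner_self_nonneg _ _
  have hpen (K : Finset (Eu n)) (p : Eu n) : 0 ≤ 1 / size (face K p) *
      faceInt (face K p) (fun x => ‖tangDiff v m K p x‖ ^ 2) :=
    mul_nonneg (one_div_nonneg.2 Metric.diam_nonneg) (integral_nonneg fun x => by positivity)
  rw [hybridNorm, Real.sq_sqrt (add_nonneg (Finset.sum_nonneg fun K _ => hvol K)
    (mul_nonneg (sq_nonneg t) (add_nonneg (Finset.sum_nonneg fun K _ => hgrad K)
      (Finset.sum_nonneg fun K _ => Finset.sum_nonneg fun p _ => hpen K p)))),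
    ← Finset.sum_add_distrib, mul_add, mul_left_comm, Finset.mul_sum, Finset.mul_sum, hybridForm]
  refine add_le_add (Finset.sum_le_sum fun K _ => ?_)
    (mul_le_mul_of_nonneg_left (Finset.sum_le_sum fun K hK => ?_) (sq_nonneg t))
  · simp only [real_inner_self_eq_norm_sq]
    exact mul_le_of_le_one_left (hvol K) hC1
  · have hfaces := Finset.sum_le_sum fun p hp =>
      face_terms_ge hn hk hV hvV hv hm hK hp α hε
    rw [Finset.sum_sub_distrib, ← Finset.mul_sum, Finset.sum_const,
      (T.mem_elements.1 hK).2, nsmul_eq_mul] at hfaces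
    have h1 := mul_le_mul_of_nonneg_right hCgrad (hgrad K)
    have h2 := mul_le_mul_of_nonneg_right hCpen
      (Finset.sum_nonneg fun p (_ : p ∈ K) => hpen K p)
    push_cast at hfaces
    rw [mul_add]
    linarith

end Brinkman

theorem mainTheorem2 (n : ℕ) (hn : n = 2 ∨ n = 3) (fam : Brinkman.Family) (k : ℕ) (hk : 1 ≤ k) :
    (∀ κ : ℝ, 0 < κ → ∃ CI : ℝ, 0 < CI ∧
      ∀ (Ω : Set (Brinkman.Eu n)) (T : Brinkman.SimplicialMesh Ω), IsOpen Ω → IsConnected Ω →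
        T.ShapeRegular κ →
        Brinkman.InverseTrace T (Brinkman.conformingSpace T fam k) CI ∧
        Brinkman.InverseTrace T (Brinkman.brokenSpace T fam k) CI) ∧
    (∀ CI : ℝ, 0 < CI → ∀ α : ℝ, (n + 1) * CI / 2 < α → ∃ C : ℝ, 0 < C ∧
      ∀ (Ω : Set (Brinkman.Eu n)) (T : Brinkman.SimplicialMesh Ω), IsOpen Ω → IsConnected Ω →
        ∀ V : Set (Brinkman.BrokenField n),
          (V = Brinkman.conformingSpace T fam k ∨ V = Brinkman.brokenSpace T fam k) →
          Brinkman.InverseTrace T V CI →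
        ∀ σ : Finset (Brinkman.Eu n) → ℝ, (∀ K ∈ T.elements, 0 < σ K) →
        ∀ t : ℝ, 0 ≤ t →
        ∀ M : Submodule ℝ (MeasureTheory.Lp (Brinkman.Eu n) 2 T.skeletonMeasure),
        ∀ v ∈ V, ∀ m ∈ M,
          C * Brinkman.hybridNorm T σ t v m ^ 2 ≤ Brinkman.hybridForm T σ t α v m v m) := by
  have hn2 : 2 ≤ n := by omega
  refine ⟨fun κ hκ => ?_, fun CI hCI α hα => ?_⟩
  · obtain ⟨CI, hCI, h⟩ := Brinkman.exists_inverseTrace n hn2 fam k hk κ hκ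
    exact ⟨CI, hCI, fun Ω T _ _ hT => ⟨fun v hv => h Ω T hT v hv.1, h Ω T hT⟩⟩
  · -- The hypothesis on `α` leaves room for a Young parameter strictly between `1 / (2 α)` and
    -- `1 / ((n + 1) C_I)`.
    have hnCI : 0 < ((n : ℝ) + 1) * CI := by positivity
    obtain ⟨ε, hε1, hε2⟩ := exists_between (inv_strictAnti₀ hnCI (by linarith :
      ((n : ℝ) + 1) * CI < 2 * α))
    have hα2 : 0 < 2 * α := by linarith
    have hε : 0 < ε := (inv_pos.2 hα2).trans hε1
    have hgrad : 0 < 1 - ((n : ℝ) + 1) * (ε * CI) := by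
      have := (lt_inv_comm₀ hε hnCI).1 hε2
      have := mul_lt_mul_of_pos_left this hε
      rw [mul_inv_cancel₀ hε.ne'] at this
      linarith
    have hpen : 0 < 2 * α - ε⁻¹ := sub_pos.2 ((inv_lt_comm₀ hα2 hε).1 hε1)
    refine ⟨min 1 (min (1 - (n + 1) * (ε * CI)) (2 * α - ε⁻¹)), by positivity,
      fun Ω T _ _ V hV hI σ _ t _ M v hv m _ => ?_⟩
    have hvb : v ∈ Brinkman.brokenSpace T fam k := by
      rcases hV with rfl | rfl
      exacts [hv.1, hv]
    exact Brinkman.coercivity hn2 hk hI hv hvb (MeasureTheory.Lp.memLp m) σ t α hε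
      (min_le_left _ _) ((min_le_right _ _).trans (min_le_left _ _))
      ((min_le_right _ _).trans (min_le_right _ _))
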